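/- An odd continued fraction is a finite expression $$\left[0;\tfrac{\varepsilon_1}{a_1},\dots,\tfrac{\varepsilon_l}{a_l}\right]=\cfrac{\varepsilon_1}{a_1+\cfrac{\varepsilon_2}{a_2+\ldots+\cfrac{\varepsilon_l}{a_l}}}\qquad(l\ge 0;\ \text{value } 0 \text{ for } l=0),$$ where all $a_j$ are odd positive integers, $\varepsilon_j=\pm1$, $\varepsilon_1=1$, $a_j+\varepsilon_{j+1}\ge 2$ for $1\le j<l$, and $\varepsilon_l=1$ if $a_l=1$. Every $x\in\mathbb Q\cap[0,1]$ has exactly one such representation; let $S^0(x)=a_1+\dots+a_l$ be the sum of its partial quotients. For $n\in\mathbb N$ let $\mathcal Y_n=\{x\in\mathbb Q\cap[0,1]: S^0(x)\le n+1\}$, and for $x\in[0,1]$ put $$F^0_n(x)=\frac{\sharp\{\xi\in\mathcal Y_n:\xi\le x\}}{\sharp\,\mathcal Y_n},\qquad F^0(x)=\lim_{n\to\infty}F^0_n(x).$$ Let $\lambda$ be the unique real root of $\lambda^3-\lambda^2-\lambda-1=0$. Proposition 2. The limit $F^0(x)$ exists for every $x\in[0,1]$, and for every integer $n\ge1$ and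 every $x\in[0,1]$ $$\frac{F^0(x)}{\lambda^{2n-1}}=\frac1{\lambda^{2n-2}}-F^0\!\left(\frac1{2n-1+x}\right),\qquad \frac{F^0(x)}{\lambda^{2n}}=F^0\!\left(\frac1{2n+\frac1x}\right),$$ where for $x=0$ the argument $\frac{1}{2n+1/x}$ is read as $0$. -/

import Mathlib

open Filter Topology

namespace OddCF

/-- The value of the finite continued fraction
`[0; ε₁/a₁, …, ε_l/a_l] = ε₁/(a₁ + ε₂/(a₂ + ⋯ + ε_l/a_l))`,
given as the list of the pairs `(ε_j, a_j)`; the empty list stands for `0`. -/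
def value : List (ℤ × ℕ) → ℚ
  | [] => 0
  | (e, a) :: t => (e : ℚ) / ((a : ℚ) + value t)

/-- `[0; ε₁/a₁, …, ε_l/a_l]` is a (finite) odd continued fraction: every `ε_j` is `±1` and every
`a_j` is odd, `ε₁ = 1`, `a_j + ε_{j+1} ≥ 2`, and if the last partial quotient `a_l` is `1`
then `ε_l = 1`. -/
def IsOddCF (l : List (ℤ × ℕ)) : Prop :=
  (∀ p ∈ l, (p.1 = 1 ∨ p.1 = -1) ∧ Odd p.2) ∧
  (∀ p ∈ l.head?, p.1 = 1) ∧
  l.IsChain (fun p q => 2 ≤ (p.2 : ℤ) + q.1) ∧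
  (∀ p ∈ l.getLast?, p.2 = 1 → p.1 = 1)

/-- The sum `a₁ + ⋯ + a_l` of the partial quotients. -/
def quotientSum (l : List (ℤ × ℕ)) : ℕ := (l.map Prod.snd).sum

/-- The set of the rationals in `[0, 1]` whose odd continued fraction has sum of partial
quotients at most `n + 1`. -/
def Y (n : ℕ) : Set ℚ :=
  {x | (0 ≤ x ∧ x ≤ 1) ∧ ∃ l, IsOddCF l ∧ value l = x ∧ quotientSum l ≤ n + 1}

/-- The distribution function of the finite set `Y n`: the proportion of its elements `≤ x`. -/
noncomputable def Fn (n : ℕ) (x : ℝ) : ℝ :=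
  ({ξ ∈ Y n | (ξ : ℝ) ≤ x}.ncard : ℝ) / ((Y n).ncard : ℝ)

/-- The limit distribution function `F⁰(x) = lim_{n → ∞} Fn n x`. -/
noncomputable def F0 (x : ℝ) : ℝ := limUnder atTop (fun n => Fn n x)

end OddCF

/-! Let N_m(x) count the positive rationals at most x with an odd expansion of quotient sum at most
m. Three maps generate them: x ↦ x/(1+2x) onto (0,1/3] raises the sum by 2, x ↦ 1/(3-x) onto
(1/3,1/2) by 3, and x ↦ 1/(1+x) onto [1/2,1] by 1. The position of a point decides its branch, so
uniqueness of expansions is never needed. Each branch gives a counting identity (`count_div`,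
`count_inv_three_sub`, `count_inv_add`), the last up to an error of 1.

Adding the pieces, N_m(1) obeys the tribonacci recurrence. The roots other than λ have modulus below
1, so N_{m+1}(1) - λN_m(1) is bounded. The branches carry this to every x with at most linear growth
in m (`exists_count_bound`), hence N_m(x)/λ^m converges, to a fixed positive multiple of F⁰(x). The
counting identities divided by λ^m become `F0_div` and `F0_inv_add`; iterating the former gives the
second equation, and composing with the latter gives the first. -/

namespace OddCF

/-! ### Odd continued fractions as a recursion on values -/

/-- `OddRep x s`: the rational `x` has an odd continued fraction with sum of partial quotients
`s`. -/
inductive OddRep : ℚ → ℕ → Prop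
  | zero : OddRep 0 0
  | pos {a : ℕ} {y : ℚ} {s : ℕ} (ha : Odd a) (hy : OddRep y s) : OddRep (1 / (a + y)) (a + s)
  | neg {a : ℕ} {y : ℚ} {s : ℕ} (ha : Odd a) (ha3 : 3 ≤ a) (hy : OddRep y s) (h0 : y ≠ 0)
      (h1 : y ≠ 1) : OddRep (1 / (a - y)) (a + s)

theorem OddRep.mem_Icc {x : ℚ} {s : ℕ} (h : OddRep x s) : 0 ≤ x ∧ x ≤ 1 := by
  induction h with
  | zero => norm_num
  | @pos a y s ha hy ih =>
    have : (1 : ℚ) ≤ a := by exact_mod_cast ha.pos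
    refine ⟨by have := ih.1; positivity, ?_⟩
    rw [div_le_one (by linarith)]
    linarith
  | @neg a y s ha ha3 hy h0 h1 ih =>
    have : (3 : ℚ) ≤ a := by exact_mod_cast ha3
    refine ⟨div_nonneg zero_le_one (by linarith), ?_⟩
    rw [div_le_one (by linarith)]
    linarith

theorem OddRep.eq_zero {x : ℚ} {s : ℕ} (h : OddRep x s) (hx : x = 0) : s = 0 := by
  cases h with
  | zero => rfl
  | @pos a y s ha hy =>
    have : (1 : ℚ) ≤ a := by exact_mod_cast ha.pos
    have := hy.mem_Icc
    have : 0 < 1 / ((a : ℚ) + y) := div_pos one_pos (by linarith)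
    linarith
  | @neg a y s ha ha3 hy h0 h1 =>
    have : (3 : ℚ) ≤ a := by exact_mod_cast ha3
    have := hy.mem_Icc
    have : 0 < 1 / ((a : ℚ) - y) := div_pos one_pos (by linarith)
    linarith

/-- This translates the condition on the last quotient: a tail of value 1 after a minus sign is
exactly a final quotient 1 with sign -1. -/
theorem OddRep.eq_one {x : ℚ} {s : ℕ} (h : OddRep x s) (hx : x = 1) : s = 1 := by
  cases h with
  | zero => norm_num at hx
  | @pos a y s ha hy =>
    have h1 : (1 : ℚ) ≤ a := by exact_mod_cast ha.pos
    have h2 := hy.mem_Icc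
    rw [div_eq_one_iff_eq (by linarith)] at hx
    have hy0 := hy.eq_zero (by linarith)
    have : (a : ℚ) = 1 := by linarith
    have : a = 1 := by exact_mod_cast this
    omega
  | @neg a y s ha ha3 hy h0 h1 =>
    have : (3 : ℚ) ≤ a := by exact_mod_cast ha3
    have := hy.mem_Icc
    rw [div_eq_one_iff_eq (by linarith)] at hx
    linarith

theorem quotientSum_cons (p : ℤ × ℕ) (t : List (ℤ × ℕ)) :
    quotientSum (p :: t) = p.2 + quotientSum t := by simp [quotientSum]

/-- Resetting the second sign to 1 is harmless: that sign is constrained only by the quotient before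
it, and the condition at the end can only become easier. -/
theorem IsOddCF.tail {a b : ℕ} {e : ℤ} {t : List (ℤ × ℕ)} (h : IsOddCF ((1, a) :: (e, b) :: t)) :
    IsOddCF ((1, b) :: t) := by
  obtain ⟨h1, h2, h3, h4⟩ := h
  refine ⟨?_, by simp, ?_, ?_⟩
  · intro p hp
    rcases List.mem_cons.1 hp with rfl | hp
    · exact ⟨Or.inl rfl, (h1 (e, b) (by simp)).2⟩
    · exact h1 p (by simp [hp])
  · cases t with
    | nil => simp
    | cons q t => simp only [List.isChain_cons_cons] at h3 ⊢; exact h3.2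
  · cases t with
    | nil => simp
    | cons q t => simpa [List.getLast?_cons_cons] using h4

theorem IsOddCF.oddRep_cons (t : List (ℤ × ℕ)) :
    ∀ a : ℕ, IsOddCF ((1, a) :: t) → OddRep (value ((1, a) :: t)) (quotientSum ((1, a) :: t)) := by
  induction t with
  | nil =>
    intro a h
    have := OddRep.pos (h.1 (1, a) (by simp)).2 OddRep.zero
    simpa [value, quotientSum] using this
  | cons q t ih =>
    obtain ⟨e, b⟩ := q
    intro a h
    have hr := ih b h.tail
    have ha : Odd a := (h.1 (1, a) (by simp)).2
    have hb : Odd b := (h.1 (e, b) (by simp)).2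
    obtain he | he := (h.1 (e, b) (by simp)).1
    · simp only at he
      subst he
      have := OddRep.pos ha hr
      rw [quotientSum_cons]
      simpa [value] using this
    · simp only at he
      subst he
      have ha3 : 3 ≤ a := by
        have := h.2.2.1
        simp only [List.isChain_cons_cons] at this
        have := this.1
        obtain ⟨k, rfl⟩ := ha
        push_cast at this
        omega
      have h0 : value ((1, b) :: t) ≠ 0 := fun h0 => by
        have := hr.eq_zero h0
        rw [quotientSum_cons] at this
        have := hb.pos
        simp only at *
        omega
      have h1 : value ((1, b) :: t) ≠ 1 := fun h1 => by
        have hs := hr.eq_one h1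
        rw [quotientSum_cons] at hs
        have := hb.pos
        simp only at hs
        cases t with
        | nil =>
          have hl := h.2.2.2 (-1, b) (by simp)
          simp [quotientSum] at hs
          simp [hs] at hl
        | cons r t =>
          have := (h.1 r (by simp)).2.pos
          rw [quotientSum_cons] at hs
          omega
      have := OddRep.neg ha ha3 hr h0 h1
      rw [quotientSum_cons]
      convert this using 1
      · simp [value, neg_div, sub_eq_add_neg]
      · simp [quotientSum]

theorem IsOddCF.oddRep {l : List (ℤ × ℕ)} (h : IsOddCF l) : OddRep (value l) (quotientSum l) := by
  cases l with
  | nil => exact OddRep.zero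
  | cons p t =>
    obtain ⟨e, a⟩ := p
    have : e = 1 := h.2.1 (e, a) (by simp)
    subst this
    exact IsOddCF.oddRep_cons t a h

theorem OddRep.exists_list {x : ℚ} {s : ℕ} (h : OddRep x s) :
    ∃ l, IsOddCF l ∧ value l = x ∧ quotientSum l = s := by
  induction h with
  | zero => exact ⟨[], by simp [IsOddCF], rfl, rfl⟩
  | @pos a y s ha hy ih =>
    obtain ⟨l, hl, rfl, rfl⟩ := ih
    refine ⟨(1, a) :: l, ?_, by simp [value], by simp [quotientSum]⟩
    obtain ⟨h1, h2, h3, h4⟩ := hl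
    cases l with
    | nil => simpa [IsOddCF] using ha
    | cons q t =>
      refine ⟨?_, by simp, ?_, by simpa [List.getLast?_cons_cons] using h4⟩
      · intro p hp
        rcases List.mem_cons.1 hp with rfl | hp
        · exact ⟨Or.inl rfl, ha⟩
        · exact h1 p hp
      · rw [List.isChain_cons_cons]
        refine ⟨?_, h3⟩
        have := h2 q (by simp)
        have := ha.pos
        simp only
        omega
  | @neg a y s ha ha3 hy h0 h1 ih =>
    obtain ⟨l, hl, rfl, rfl⟩ := ih
    obtain ⟨g1, g2, g3, g4⟩ := hl
    cases l with
    | nil => exact absurd rfl h0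
    | cons q t =>
      obtain ⟨e, b⟩ := q
      have he : e = 1 := g2 (e, b) (by simp)
      subst he
      -- The minus sign in a - y is absorbed into the leading sign of the tail.
      refine ⟨(1, a) :: (-1, b) :: t, ⟨?_, by simp, ?_, ?_⟩, ?_, by simp [quotientSum]⟩
      · intro p hp
        simp only [List.mem_cons] at hp
        rcases hp with rfl | rfl | hp
        · exact ⟨Or.inl rfl, ha⟩
        · exact ⟨Or.inr rfl, (g1 (1, b) (by simp)).2⟩
        · exact g1 p (by simp [hp])
      · rw [List.isChain_cons_cons]
        refine ⟨by simp only; omega, ?_⟩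
        cases t with
        | nil => simp
        | cons r t => simp only [List.isChain_cons_cons] at g3 ⊢; exact g3
      · cases t with
        | nil =>
          simp only [List.getLast?_cons_cons, List.getLast?_singleton, Option.mem_def,
            Option.some.injEq, forall_eq']
          intro hb
          simp [value, hb] at h1
        | cons r t => simpa [List.getLast?_cons_cons] using g4
      · simp [value, neg_div, sub_eq_add_neg]

/-! ### The three inverse branches -/

/-- The positive rationals having an odd continued fraction with sum of partial quotients at most
`m`. -/
def posRat (m : ℕ) : Set ℚ := {x | 0 < x ∧ ∃ s ≤ m, OddRep x s}

/-- Zero is split off so that the remaining counts satisfy a homogeneous recurrence. -/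
theorem Y_eq (n : ℕ) : Y n = insert 0 (posRat (n + 1)) := by
  ext x
  simp only [Y, posRat, Set.mem_ofPred_eq, Set.mem_insert_iff]
  constructor
  · rintro ⟨⟨h0, h1⟩, l, hl, rfl, hs⟩
    rcases h0.eq_or_lt with h | h
    · exact Or.inl h.symm
    · exact Or.inr ⟨h, _, hs, hl.oddRep⟩
  · rintro (rfl | ⟨h0, s, hs, h⟩)
    · exact ⟨by norm_num, [], by simp [IsOddCF], rfl, by simp [quotientSum]⟩
    · obtain ⟨l, hl, rfl, rfl⟩ := h.exists_list
      exact ⟨h.mem_Icc, l, hl, rfl, hs⟩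

theorem le_one_of_mem_posRat {m : ℕ} {x : ℚ} (h : x ∈ posRat m) : x ≤ 1 := by
  obtain ⟨-, s, -, h⟩ := h
  exact h.mem_Icc.2

theorem posRat_mono : Monotone posRat := fun _ _ h _ hx =>
  ⟨hx.1, hx.2.choose, hx.2.choose_spec.1.trans h, hx.2.choose_spec.2⟩

theorem one_mem_posRat {m : ℕ} (hm : 1 ≤ m) : (1 : ℚ) ∈ posRat m := by
  refine ⟨one_pos, 1, hm, ?_⟩
  simpa using OddRep.pos odd_one OddRep.zero

theorem finite_oddRep (m : ℕ) : {x : ℚ | ∃ s ≤ m, OddRep x s}.Finite := by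
  induction m with
  | zero =>
    refine (Set.finite_singleton (0 : ℚ)).subset ?_
    rintro x ⟨s, hs, h⟩
    cases h with
    | zero => rfl
    | pos ha hy => have := ha.pos; omega
    | neg ha ha3 hy h0 h1 => omega
  | succ m ih =>
    refine ((Set.finite_singleton (0 : ℚ)).union
      (((((Set.finite_Iic (m + 1)).prod ih).image fun p => 1 / ((p.1 : ℚ) + p.2)).union
      (((Set.finite_Iic (m + 1)).prod ih).image fun p => 1 / ((p.1 : ℚ) - p.2))))).subset ?_
    rintro x ⟨s, hs, h⟩
    cases h with
    | zero => exact Or.inl rfl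
    | @pos a y s ha hy =>
      have := ha.pos
      exact Or.inr (Or.inl ⟨(a, y), ⟨by simp only [Set.mem_Iic]; omega, s, by omega, hy⟩, rfl⟩)
    | @neg a y s ha ha3 hy h0 h1 =>
      exact Or.inr (Or.inr ⟨(a, y), ⟨by simp only [Set.mem_Iic]; omega, s, by omega, hy⟩, rfl⟩)

theorem finite_posRat (m : ℕ) : (posRat m).Finite :=
  (finite_oddRep m).subset fun _ h => h.2

/-- The map adds 2 to 1/x, that is, to the first quotient. -/
theorem div_mem_posRat {m : ℕ} {x : ℚ} (h : x ∈ posRat m) : x / (1 + 2 * x) ∈ posRat (m + 2) := by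
  obtain ⟨h0, s, hs, h⟩ := h
  refine ⟨by positivity, s + 2, by omega, ?_⟩
  cases h with
  | zero => exact absurd h0 (lt_irrefl _)
  | @pos a y s ha hy =>
    have := OddRep.pos (ha.add_even even_two) hy
    have h1 : (1 : ℚ) ≤ a := by exact_mod_cast ha.pos
    have h2 := hy.mem_Icc.1
    have h3 : (a : ℚ) + y ≠ 0 := by linarith
    convert this using 1
    · push_cast; field_simp; ring
    · ring
  | @neg a y s ha ha3 hy g0 g1 =>
    have := OddRep.neg (ha.add_even even_two) (by omega) hy g0 g1
    have h1 : (3 : ℚ) ≤ a := by exact_mod_cast ha3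
    have h2 := hy.mem_Icc.2
    have h3 : (a : ℚ) - y ≠ 0 := by linarith
    convert this using 1
    · push_cast; field_simp; ring
    · ring

/-- The denominator is at least 3, which forces a ≥ 3 in a + y and a ≥ 5 in a - y, so 2 can be
subtracted from a. -/
theorem exists_of_le_third {m : ℕ} {x : ℚ} (h : x ∈ posRat (m + 2)) (hx : x ≤ 1 / 3) :
    ∃ y ∈ posRat m, y / (1 + 2 * y) = x := by
  obtain ⟨h0, s, hs, h⟩ := h
  cases h with
  | zero => exact absurd h0 (lt_irrefl _)
  | @pos a y s ha hy =>
    have hy1 := hy.mem_Icc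
    have h1 : (1 : ℚ) ≤ a := by exact_mod_cast ha.pos
    rw [div_le_div_iff_of_pos_left one_pos (by linarith) (by norm_num)] at hx
    obtain ⟨k, rfl⟩ := ha
    obtain _ | k := k
    · norm_num at hx; linarith
    · have hk : (0 : ℚ) ≤ k := k.cast_nonneg
      refine ⟨1 / ((2 * k + 1 : ℕ) + y), ⟨?_, _, ?_, OddRep.pos ⟨k, rfl⟩ hy⟩, ?_⟩
      · exact div_pos one_pos (by push_cast; linarith)
      · omega
      · have : 2 * (k : ℚ) + 1 + y ≠ 0 := by linarith
        push_cast
        field_simp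
        ring
  | @neg a y s ha ha3 hy g0 g1 =>
    have hy1 := hy.mem_Icc
    have hy0 : 0 < y := lt_of_le_of_ne hy1.1 g0.symm
    have h2 : (3 : ℚ) ≤ a := by exact_mod_cast ha3
    rw [div_le_div_iff_of_pos_left one_pos (by linarith) (by norm_num)] at hx
    obtain ⟨k, rfl⟩ := ha
    obtain _ | _ | k := k
    · omega
    · norm_num at hx; linarith
    · have hk : (0 : ℚ) ≤ k := k.cast_nonneg
      refine ⟨1 / ((2 * (k + 1) + 1 : ℕ) - y),
        ⟨?_, _, ?_, OddRep.neg ⟨k + 1, rfl⟩ (by omega) hy g0 g1⟩, ?_⟩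
      · exact div_pos one_pos (by push_cast; linarith)
      · omega
      · have : 2 * ((k : ℚ) + 1) + 1 - y ≠ 0 := by linarith
        push_cast
        field_simp
        ring

theorem one_div_mem_posRat {m : ℕ} {x : ℚ} (h : x ∈ insert 0 (posRat m)) :
    1 / (1 + x) ∈ posRat (m + 1) := by
  have : ∃ s ≤ m, OddRep x s := by
    rcases h with rfl | h
    · exact ⟨0, by omega, OddRep.zero⟩
    · exact h.2
  obtain ⟨s, hs, h⟩ := this
  have := h.mem_Icc
  refine ⟨div_pos one_pos (by linarith), 1 + s, by omega, ?_⟩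
  simpa using OddRep.pos odd_one h

/-- The denominator is at most 2; since 3 - y > 2 for y < 1, only 1 + y remains. -/
theorem exists_of_half_le {m : ℕ} {x : ℚ} (h : x ∈ posRat (m + 1)) (hx : 1 / 2 ≤ x) :
    ∃ y ∈ insert 0 (posRat m), 1 / (1 + y) = x := by
  obtain ⟨h0, s, hs, h⟩ := h
  cases h with
  | zero => exact absurd h0 (lt_irrefl _)
  | @pos a y s ha hy =>
    have hy1 := hy.mem_Icc
    have h1 : (1 : ℚ) ≤ a := by exact_mod_cast ha.pos
    rw [div_le_div_iff_of_pos_left one_pos (by norm_num) (by linarith)] at hx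
    obtain ⟨k, rfl⟩ := ha
    obtain _ | k := k
    · refine ⟨y, ?_, by norm_num⟩
      rcases hy1.1.eq_or_lt with h | h
      · exact Or.inl h.symm
      · exact Or.inr ⟨h, s, by omega, hy⟩
    · push_cast at hx
      have hk : (0 : ℚ) ≤ k := k.cast_nonneg
      linarith
  | @neg a y s ha ha3 hy g0 g1 =>
    have hy1 := hy.mem_Icc
    have hy0 : y < 1 := lt_of_le_of_ne hy1.2 g1
    have h2 : (3 : ℚ) ≤ a := by exact_mod_cast ha3
    rw [div_le_div_iff_of_pos_left one_pos (by norm_num) (by linarith)] at hx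
    linarith

theorem one_div_three_sub_mem_posRat {m : ℕ} {x : ℚ} (h : x ∈ posRat m) (hx : x < 1) :
    1 / (3 - x) ∈ posRat (m + 3) := by
  obtain ⟨h0, s, hs, h⟩ := h
  refine ⟨div_pos one_pos (by linarith), 3 + s, by omega, ?_⟩
  exact_mod_cast OddRep.neg (a := 3) (by decide) le_rfl h h0.ne' hx.ne

/-- A denominator strictly between 2 and 3 can only be 3 - y. -/
theorem exists_of_third_lt {m : ℕ} {x : ℚ} (h : x ∈ posRat (m + 3)) (hx : 1 / 3 < x)
    (hx2 : x < 1 / 2) : ∃ y ∈ posRat m, y < 1 ∧ 1 / (3 - y) = x := by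
  obtain ⟨h0, s, hs, h⟩ := h
  cases h with
  | zero => exact absurd h0 (lt_irrefl _)
  | @pos a y s ha hy =>
    have hy1 := hy.mem_Icc
    have h1 : (1 : ℚ) ≤ a := by exact_mod_cast ha.pos
    rw [div_lt_div_iff_of_pos_left one_pos (by norm_num) (by linarith)] at hx
    rw [div_lt_div_iff_of_pos_left one_pos (by linarith) (by norm_num)] at hx2
    obtain ⟨k, rfl⟩ := ha
    obtain _ | k := k
    · norm_num at hx2; linarith
    · push_cast at hx
      have hk : (0 : ℚ) ≤ k := k.cast_nonneg
      linarith
  | @neg a y s ha ha3 hy g0 g1 =>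
    have hy1 := hy.mem_Icc
    have hy0 : y < 1 := lt_of_le_of_ne hy1.2 g1
    have h2 : (3 : ℚ) ≤ a := by exact_mod_cast ha3
    rw [div_lt_div_iff_of_pos_left one_pos (by norm_num) (by linarith)] at hx
    obtain ⟨k, rfl⟩ := ha
    obtain _ | _ | k := k
    · omega
    · exact ⟨y, ⟨lt_of_le_of_ne hy1.1 g0.symm, s, by omega, hy⟩, hy0, by norm_num⟩
    · push_cast at hx
      have hk : (0 : ℚ) ≤ k := k.cast_nonneg
      linarith

end OddCF

/-! ### Counting identities -/

namespace OddCF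

/-- The free condition `P` allows both counting up to a threshold and, when trivial, counting the
whole piece. -/
theorem ncard_posRat_le_third (m : ℕ) (P : ℚ → Prop) :
    {ξ ∈ posRat (m + 2) | ξ ≤ 1 / 3 ∧ P ξ}.ncard
      = {η ∈ posRat m | P (η / (1 + 2 * η))}.ncard := by
  refine Eq.trans ?_ (Set.InjOn.ncard_image (f := fun η : ℚ => η / (1 + 2 * η)) ?_)
  · congr 1
    ext ξ
    simp only [Set.mem_image, Set.mem_ofPred_eq]
    constructor
    · rintro ⟨h, h3, hP⟩
      obtain ⟨η, hη, rfl⟩ := exists_of_le_third h h3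
      exact ⟨η, ⟨hη, hP⟩, rfl⟩
    · rintro ⟨η, ⟨hη, hP⟩, rfl⟩
      refine ⟨div_mem_posRat hη, ?_, hP⟩
      have h0 := hη.1
      have h1 := le_one_of_mem_posRat hη
      rw [div_le_div_iff₀ (by linarith) (by norm_num)]
      linarith
  · rintro x ⟨hx, -⟩ y ⟨hy, -⟩ h
    have h0 := hx.1
    have h1 := hy.1
    simp only at h
    rw [div_eq_div_iff (by linarith) (by linarith)] at h
    linarith

theorem ncard_half_le_posRat (m : ℕ) (P : ℚ → Prop) :
    {ξ ∈ posRat (m + 1) | 1 / 2 ≤ ξ ∧ P ξ}.ncard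
      = {η ∈ insert 0 (posRat m) | P (1 / (1 + η))}.ncard := by
  have key : ∀ η ∈ insert 0 (posRat m), 0 ≤ η ∧ η ≤ 1 := by
    rintro η (rfl | h)
    · norm_num
    · exact ⟨h.1.le, le_one_of_mem_posRat h⟩
  refine Eq.trans ?_ (Set.InjOn.ncard_image (f := fun η : ℚ => 1 / (1 + η)) ?_)
  · congr 1
    ext ξ
    simp only [Set.mem_image, Set.mem_ofPred_eq]
    constructor
    · rintro ⟨h, h3, hP⟩
      obtain ⟨η, hη, rfl⟩ := exists_of_half_le h h3
      exact ⟨η, ⟨hη, hP⟩, rfl⟩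
    · rintro ⟨η, ⟨hη, hP⟩, rfl⟩
      refine ⟨one_div_mem_posRat hη, ?_, hP⟩
      have := key η hη
      rw [div_le_div_iff₀ (by norm_num) (by linarith)]
      linarith
  · rintro x ⟨hx, -⟩ y ⟨hy, -⟩ h
    have := key x hx
    have := key y hy
    simp only at h
    rw [div_eq_div_iff (by linarith) (by linarith)] at h
    linarith

theorem ncard_third_lt_posRat (m : ℕ) (P : ℚ → Prop) :
    {ξ ∈ posRat (m + 3) | (1 / 3 < ξ ∧ ξ < 1 / 2) ∧ P ξ}.ncard
      = {η ∈ posRat m | η < 1 ∧ P (1 / (3 - η))}.ncard := by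
  refine Eq.trans ?_ (Set.InjOn.ncard_image (f := fun η : ℚ => 1 / (3 - η)) ?_)
  · congr 1
    ext ξ
    simp only [Set.mem_image, Set.mem_ofPred_eq]
    constructor
    · rintro ⟨h, h3, hP⟩
      obtain ⟨η, hη, hlt, rfl⟩ := exists_of_third_lt h h3.1 h3.2
      exact ⟨η, ⟨hη, hlt, hP⟩, rfl⟩
    · rintro ⟨η, ⟨hη, hlt, hP⟩, rfl⟩
      have h0 := hη.1
      refine ⟨one_div_three_sub_mem_posRat hη hlt, ⟨?_, ?_⟩, hP⟩ <;>
      · rw [div_lt_div_iff₀ (by linarith) (by linarith)]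
        linarith
  · rintro x ⟨-, hx, -⟩ y ⟨-, hy, -⟩ h
    simp only at h
    rw [div_eq_div_iff (by linarith) (by linarith)] at h
    linarith

/-- The number of elements of `posRat m` that are at most `x`. -/
noncomputable def count (m : ℕ) (x : ℝ) : ℕ := {ξ ∈ posRat m | (ξ : ℝ) ≤ x}.ncard

theorem count_one (m : ℕ) : count m 1 = (posRat m).ncard := by
  unfold count
  congr 1
  ext ξ
  simp only [Set.mem_ofPred_eq, and_iff_left_iff_imp]
  intro h
  exact_mod_cast le_one_of_mem_posRat h

theorem count_le_one (m : ℕ) (x : ℝ) : count m x ≤ count m 1 := by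
  rw [count_one]
  exact Set.ncard_le_ncard (Set.sep_subset _ _) (finite_posRat m)

theorem count_mono {m n : ℕ} (h : m ≤ n) (x : ℝ) : count m x ≤ count n x :=
  Set.ncard_le_ncard (fun _ hξ => ⟨posRat_mono h hξ.1, hξ.2⟩)
    ((finite_posRat n).subset (Set.sep_subset _ _))

theorem count_zero_right (m : ℕ) : count m 0 = 0 := by
  unfold count
  convert Set.ncard_empty ℚ
  ext ξ
  simp only [Set.mem_ofPred_eq, Set.mem_empty_iff_false, iff_false, not_and, not_le]
  intro h
  exact_mod_cast h.1

theorem one_le_count_one {m : ℕ} (hm : 1 ≤ m) : 1 ≤ count m 1 := by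
  rw [count_one]
  exact (Set.ncard_pos (finite_posRat m)).2 ⟨1, one_mem_posRat hm⟩

theorem count_div (m : ℕ) {x : ℝ} (h0 : 0 ≤ x) (h1 : x ≤ 1) :
    count (m + 2) (x / (1 + 2 * x)) = count m x := by
  have := ncard_posRat_le_third m (fun ξ => (ξ : ℝ) ≤ x / (1 + 2 * x))
  unfold count
  convert this using 2
  · ext ξ
    simp only [Set.mem_ofPred_eq, and_congr_right_iff, iff_and_self]
    intro _ h
    have : x / (1 + 2 * x) ≤ 1 / 3 := by
      rw [div_le_div_iff₀ (by linarith) (by norm_num)]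
      linarith
    have : (ξ : ℝ) ≤ ((1 / 3 : ℚ) : ℝ) := by push_cast; linarith
    exact_mod_cast this
  · ext η
    simp only [Set.mem_ofPred_eq, and_congr_right_iff]
    intro h
    have : (0 : ℝ) < η := by exact_mod_cast h.1
    push_cast
    rw [div_le_div_iff₀ (by linarith) (by linarith)]
    constructor <;> intro h <;> linarith

/-- The branch reverses order: elements at least 1/(1+x) come from 0 and from the elements at most
x. They overlap the elements at most 1/(1+x) in the threshold alone, if at all. -/
theorem count_inv_add (m : ℕ) {x : ℝ} (h0 : 0 ≤ x) (h1 : x ≤ 1) :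
    count (m + 1) (1 / (1 + x)) + count m x ≤ count (m + 1) 1 ∧
      count (m + 1) 1 ≤ count (m + 1) (1 / (1 + x)) + count m x + 1 := by
  have key := ncard_half_le_posRat m (fun ξ => 1 / (1 + x) ≤ (ξ : ℝ))
  set T := {ξ ∈ posRat (m + 1) | 1 / (1 + x) ≤ (ξ : ℝ)} with hT
  have hT1 : T.ncard = count m x + 1 := by
    have e1 : T = {ξ ∈ posRat (m + 1) | 1 / 2 ≤ ξ ∧ 1 / (1 + x) ≤ (ξ : ℝ)} := by
      ext ξ
      simp only [hT, Set.mem_ofPred_eq, and_congr_right_iff, iff_and_self]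
      intro _ h
      have : 1 / 2 ≤ 1 / (1 + x) := by
        rw [div_le_div_iff₀ (by norm_num) (by linarith)]
        linarith
      have : ((1 / 2 : ℚ) : ℝ) ≤ (ξ : ℝ) := by push_cast; linarith
      exact_mod_cast this
    have e2 : {η ∈ insert 0 (posRat m) | 1 / (1 + x) ≤ ((1 / (1 + η) : ℚ) : ℝ)}
        = insert 0 {η ∈ posRat m | (η : ℝ) ≤ x} := by
      ext η
      simp only [Set.mem_ofPred_eq, Set.mem_insert_iff]
      have h2 : ∀ η : ℚ, 0 ≤ η → (1 / (1 + x) ≤ ((1 / (1 + η) : ℚ) : ℝ) ↔ (η : ℝ) ≤ x) := by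
        intro η hη
        have : (0 : ℝ) ≤ η := by exact_mod_cast hη
        push_cast
        rw [div_le_div_iff₀ (by linarith) (by linarith)]
        constructor <;> intro h <;> linarith
      constructor
      · rintro ⟨rfl | h, h3⟩
        · exact Or.inl rfl
        · exact Or.inr ⟨h, (h2 η h.1.le).1 h3⟩
      · rintro (rfl | ⟨h, h3⟩)
        · exact ⟨Or.inl rfl, (h2 0 le_rfl).2 (by exact_mod_cast h0)⟩
        · exact ⟨Or.inr h, (h2 η h.1.le).2 h3⟩
    rw [e1, key, e2, Set.ncard_insert_of_notMem (fun h => lt_irrefl _ h.1.1)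
      ((finite_posRat m).subset (Set.sep_subset _ _))]
    rfl
  have hfin : T.Finite := (finite_posRat _).subset (Set.sep_subset _ _)
  have hfin2 : {ξ ∈ posRat (m + 1) | (ξ : ℝ) ≤ 1 / (1 + x)}.Finite :=
    (finite_posRat _).subset (Set.sep_subset _ _)
  have hunion : {ξ ∈ posRat (m + 1) | (ξ : ℝ) ≤ 1 / (1 + x)} ∪ T = posRat (m + 1) := by
    ext ξ
    simp only [hT, Set.mem_union, Set.mem_ofPred_eq]
    have := le_total (ξ : ℝ) (1 / (1 + x))
    tauto
  have hinter : ({ξ ∈ posRat (m + 1) | (ξ : ℝ) ≤ 1 / (1 + x)} ∩ T).ncard ≤ 1 := by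
    rw [Set.ncard_le_one (hfin2.inter_of_left _)]
    rintro a ⟨⟨_, h1⟩, ⟨_, h2⟩⟩ b ⟨⟨_, h3⟩, ⟨_, h4⟩⟩
    have : (a : ℝ) = b := by linarith
    exact_mod_cast this
  have := Set.ncard_union_add_ncard_inter _ _ hfin2 hfin
  rw [hunion, hT1, ← count_one] at this
  change _ = count _ _ + _ at this
  omega

/-- Everything up to 1/3 is counted, then the images of the elements at most x; x < 1 keeps the
threshold below 1/2. -/
theorem count_inv_three_sub (m : ℕ) {x : ℝ} (h0 : 0 ≤ x) (h1 : x < 1) :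
    count (m + 3) (1 / (3 - x)) = count (m + 1) 1 + count m x := by
  have k1 := ncard_posRat_le_third (m + 1) (fun _ => True)
  have k2 := ncard_third_lt_posRat m (fun ξ => (ξ : ℝ) ≤ 1 / (3 - x))
  simp only [and_true] at k1
  have hx3 : 1 / 3 ≤ 1 / (3 - x) := by
    rw [div_le_div_iff₀ (by norm_num) (by linarith)]
    linarith
  have hx2 : 1 / (3 - x) < 1 / 2 := by
    rw [div_lt_div_iff₀ (by linarith) (by norm_num)]
    linarith
  have e : {η ∈ posRat m | η < 1 ∧ ((1 / (3 - η) : ℚ) : ℝ) ≤ 1 / (3 - x)}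
      = {η ∈ posRat m | (η : ℝ) ≤ x} := by
    ext η
    simp only [Set.mem_ofPred_eq, and_congr_right_iff]
    intro h
    have hη : (η : ℝ) ≤ 1 := by exact_mod_cast le_one_of_mem_posRat h
    push_cast
    rw [div_le_div_iff₀ (by linarith) (by linarith)]
    constructor
    · rintro ⟨-, h⟩
      linarith
    · intro h
      refine ⟨?_, by linarith⟩
      have : (η : ℝ) < 1 := by linarith
      exact_mod_cast this
  rw [e] at k2
  have k3 : (posRat (m + 1)).ncard = count (m + 1) 1 := (count_one _).symm
  rw [show {η | η ∈ posRat (m + 1)} = posRat (m + 1) from rfl, k3] at k1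
  rw [← k1, count, count, ← k2, ← Set.ncard_union_eq ?_
    ((finite_posRat _).subset (Set.sep_subset _ _)) ((finite_posRat _).subset (Set.sep_subset _ _))]
  · congr 1
    ext ξ
    simp only [Set.mem_union, Set.mem_ofPred_eq]
    have c1 : ξ ≤ 1 / 3 → (ξ : ℝ) ≤ 1 / (3 - x) := fun h => by
      have : (ξ : ℝ) ≤ ((1 / 3 : ℚ) : ℝ) := by exact_mod_cast h
      push_cast at this
      linarith
    have c2 : (ξ : ℝ) ≤ 1 / (3 - x) → ξ < 1 / 2 := fun h => by
      have : (ξ : ℝ) < ((1 / 2 : ℚ) : ℝ) := by push_cast; linarith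
      exact_mod_cast this
    have := le_or_gt ξ (1 / 3)
    tauto
  · rw [Set.disjoint_left]
    rintro ξ ⟨-, h⟩ ⟨-, ⟨h2, -⟩, -⟩
    exact absurd h (not_le.2 h2)

/-- The middle branch loses the point 1 and the branch onto [1/2,1] gains the point 0; the two
corrections cancel. -/
theorem count_one_tribonacci (m : ℕ) :
    count (m + 4) 1 = count (m + 3) 1 + count (m + 2) 1 + count (m + 1) 1 := by
  have k1 := ncard_posRat_le_third (m + 2) (fun _ => True)
  have k2 := ncard_third_lt_posRat (m + 1) (fun _ => True)
  have k3 := ncard_half_le_posRat (m + 3) (fun _ => True)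
  simp only [and_true] at k1 k2 k3
  have fin : ∀ (m : ℕ) (P : ℚ → Prop), {ξ ∈ posRat m | P ξ}.Finite := fun m P =>
    (finite_posRat m).subset (Set.sep_subset _ _)
  have t : ∀ s : Set ℚ, {η | η ∈ s} = s := fun _ => rfl
  rw [t] at k1 k3
  rw [Set.ncard_insert_of_notMem (fun h => lt_irrefl _ h.1) (finite_posRat _)] at k3
  have e2 : {η ∈ posRat (m + 1) | η < 1}.ncard + 1 = (posRat (m + 1)).ncard := by
    rw [← Set.ncard_insert_of_notMem (a := 1) _ (fin _ _)]
    · congr 1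
      ext ξ
      simp only [Set.mem_insert_iff, Set.mem_ofPred_eq]
      constructor
      · rintro (rfl | h)
        · exact one_mem_posRat (by omega)
        · exact h.1
      · intro h
        rcases (le_one_of_mem_posRat h).eq_or_lt with h1 | h1
        · exact Or.inl h1
        · exact Or.inr ⟨h, h1⟩
    · exact fun h => lt_irrefl _ h.2
  have hU : posRat (m + 4) = ({ξ ∈ posRat (m + 2 + 2) | ξ ≤ 1 / 3} ∪
      {ξ ∈ posRat (m + 1 + 3) | 1 / 3 < ξ ∧ ξ < 1 / 2}) ∪
      {ξ ∈ posRat (m + 3 + 1) | 1 / 2 ≤ ξ} := by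
    ext ξ
    simp only [Set.mem_union, Set.mem_ofPred_eq]
    have := le_or_gt ξ (1 / 3)
    have := le_or_gt (1 / 2) ξ
    tauto
  simp only [count_one]
  rw [hU, Set.ncard_union_eq _ ((fin _ _).union (fin _ _)) (fin _ _),
    Set.ncard_union_eq _ (fin _ _) (fin _ _), k1, k2, k3]
  · omega
  · rw [Set.disjoint_left]
    rintro ξ ⟨-, h⟩ ⟨-, h2, -⟩
    linarith
  · rw [Set.disjoint_left]
    rintro ξ (⟨-, h⟩ | ⟨-, -, h⟩) ⟨-, h2⟩ <;> linarith

theorem Fn_eq (n : ℕ) {x : ℝ} (h0 : 0 ≤ x) :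
    Fn n x = (count (n + 1) x + 1) / (count (n + 1) 1 + 1) := by
  have hz : (0 : ℚ) ∉ posRat (n + 1) := fun h => lt_irrefl _ h.1
  have e : {ξ ∈ Y n | (ξ : ℝ) ≤ x} = insert 0 {ξ ∈ posRat (n + 1) | (ξ : ℝ) ≤ x} := by
    rw [Y_eq]
    ext ξ
    simp only [Set.mem_insert_iff, Set.mem_ofPred_eq]
    constructor
    · rintro ⟨rfl | h, h2⟩
      · exact Or.inl rfl
      · exact Or.inr ⟨h, h2⟩
    · rintro (rfl | h)
      · exact ⟨Or.inl rfl, by exact_mod_cast h0⟩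
      · exact ⟨Or.inr h.1, h.2⟩
  rw [Fn, e, Y_eq, Set.ncard_insert_of_notMem (fun h => hz h.1)
    ((finite_posRat _).subset (Set.sep_subset _ _)),
    Set.ncard_insert_of_notMem hz (finite_posRat _), ← count_one, count]
  push_cast
  rfl

end OddCF

/-! ### The tribonacci recurrence -/

theorem tribonacci_root_bounds {lam : ℝ} (hlam : lam ^ 3 - lam ^ 2 - lam - 1 = 0) :
    9 / 5 < lam ∧ lam < 19 / 10 := by
  constructor
  · by_contra! h
    nlinarith [mul_nonneg (sub_nonneg.2 h)
      -- This quadratic is the quotient of the cubic by lam - 9/5, with remainder -26/125; the other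
      -- half uses 19/10 likewise.
      (by nlinarith [sq_nonneg (lam + 2 / 5)] : 0 ≤ lam ^ 2 + 4 / 5 * lam + 11 / 25)]
  · by_contra! h
    nlinarith [mul_nonneg (sub_nonneg.2 h) (by positivity : 0 ≤ lam ^ 2 + 9 / 10 * lam + 71 / 100)]

/-- A solution of the tribonacci recurrence satisfies the first order recurrence of the dominant
root up to a bounded error. -/
theorem tribonacci_bounded {lam : ℝ} (hlam : lam ^ 3 - lam ^ 2 - lam - 1 = 0) {u : ℕ → ℝ}
    (hu : ∀ m, u (m + 3) = u (m + 2) + u (m + 1) + u m) :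
    ∃ K, ∀ m, |u (m + 1) - lam * u m| ≤ K := by
  obtain ⟨hl, hl'⟩ := tribonacci_root_bounds hlam
  -- The other two roots have product q = 1/lam and sum 1 - lam; the defect `e` obeys their second
  -- order recurrence.
  set q := lam ^ 2 - lam - 1 with hq
  have hq1 : lam * q = 1 := by rw [hq]; linarith
  have hq2 : 1 / 2 < q := by nlinarith
  have hq3 : q < 1 := by nlinarith
  set e : ℕ → ℝ := fun m => u (m + 1) - lam * u m with he
  have hrec : ∀ m, e (m + 2) = -(lam - 1) * e (m + 1) - q * e m := fun m => by
    simp only [he, hu m]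
    rw [hq]
    linear_combination -u m * hlam
  -- With β one of these conjugate roots, Q m = |e (m+1) - β e m|², so each step multiplies it by
  -- |β|² = q < 1.
  set Q : ℕ → ℝ := fun m => e (m + 1) ^ 2 + (lam - 1) * e (m + 1) * e m + q * e m ^ 2 with hQ
  have hQrec : ∀ m, Q (m + 1) = q * Q m := fun m => by
    simp only [hQ, hrec m]
    ring
  have hbound : ∀ m, e m ^ 2 * (1 / 4) ≤ Q m := fun m => by
    simp only [hQ]
    have : (lam - 1) ^ 2 / 4 + 1 / 4 ≤ q := by nlinarith
    nlinarith [sq_nonneg (e (m + 1) + (lam - 1) / 2 * e m), mul_nonneg (sub_nonneg.2 this)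
      (sq_nonneg (e m))]
  have hQ0 : ∀ m, Q m ≤ Q 0 := fun m => by
    induction m with
    | zero => exact le_rfl
    | succ m ih =>
      rw [hQrec]
      nlinarith [hbound m, sq_nonneg (e m)]
  refine ⟨4 * Q 0 + 1, fun m => ?_⟩
  change |e m| ≤ _
  have h1 := hbound m
  have h2 := hQ0 m
  rw [← sq_abs] at h1
  nlinarith [sq_nonneg (|e m| - 1)]

/-- Powers of lam obey the same recurrence, and the factor lam² covers the three initial values.
This makes the limit at x = 1 positive. -/
theorem pow_le_of_tribonacci {lam : ℝ} (hlam : lam ^ 3 - lam ^ 2 - lam - 1 = 0) {u : ℕ → ℝ}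
    (hu : ∀ m, u (m + 3) = u (m + 2) + u (m + 1) + u m) (h0 : 1 ≤ u 0) (h1 : 1 ≤ u 1)
    (h2 : 1 ≤ u 2) (m : ℕ) : lam ^ m ≤ lam ^ 2 * u m := by
  obtain ⟨hl, hl'⟩ := tribonacci_root_bounds hlam
  induction m using Nat.strong_induction_on with
  | _ m ih =>
    match m with
    | 0 => nlinarith
    | 1 => nlinarith
    | 2 => nlinarith
    | m + 3 =>
      have e : lam ^ (m + 3) = lam ^ (m + 2) + lam ^ (m + 1) + lam ^ m := by
        linear_combination lam ^ m * hlam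
      rw [e, hu]
      linarith [ih m (by omega), ih (m + 1) (by omega), ih (m + 2) (by omega)]

/-! ### Existence of the limit -/

namespace OddCF

/-- Strong induction on m, for all x at once because each branch moves x. A step adds at most K₀
from the total count and 1 + lam from the unit errors of `count_inv_add`. -/
theorem exists_count_bound {lam : ℝ} (hlam : lam ^ 3 - lam ^ 2 - lam - 1 = 0) :
    ∃ K : ℝ, ∀ m : ℕ, ∀ x ∈ Set.Icc (0 : ℝ) 1,
      |(count (m + 1) x : ℝ) - lam * count m x| ≤ K * (m + 1) := by
  obtain ⟨hl, hl'⟩ := tribonacci_root_bounds hlam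
  obtain ⟨K₀, hK₀⟩ := tribonacci_bounded hlam (u := fun m => (count (m + 1) 1 : ℝ))
    (fun m => by exact_mod_cast count_one_tribonacci m)
  have hK₀0 : 0 ≤ K₀ := (abs_nonneg _).trans (hK₀ 0)
  -- The last summand covers the base cases m < 3.
  obtain ⟨K, hK⟩ : ∃ K, K = K₀ + 1 + lam + (1 + lam) * count 3 1 := ⟨_, rfl⟩
  have hc3 : (0 : ℝ) ≤ count 3 1 := Nat.cast_nonneg _
  have hK1 : K₀ + 1 + lam ≤ K := by nlinarith
  have hK0 : 0 ≤ K := by linarith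
  refine ⟨K, fun m => ?_⟩
  induction m using Nat.strong_induction_on with
  | _ m ih =>
    intro x hx
    obtain hm | ⟨m, rfl⟩ : m < 3 ∨ ∃ k, m = k + 3 :=
      (lt_or_ge m 3).imp_right fun h => ⟨m - 3, by omega⟩
    · have b1 : (count (m + 1) x : ℝ) ≤ count 3 1 := by
        exact_mod_cast (count_mono (by omega) x).trans (count_le_one 3 x)
      have b2 : (count m x : ℝ) ≤ count 3 1 := by
        exact_mod_cast (count_mono (by omega) x).trans (count_le_one 3 x)
      have b3 : (0 : ℝ) ≤ count (m + 1) x := Nat.cast_nonneg _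
      have b4 : (0 : ℝ) ≤ count m x := Nat.cast_nonneg _
      have : K * 1 ≤ K * (m + 1) :=
        mul_le_mul_of_nonneg_left (by linarith [(Nat.cast_nonneg m : (0 : ℝ) ≤ m)]) hK0
      refine le_trans ?_ this
      rw [abs_le]
      constructor <;> nlinarith
    · push_cast
      rcases le_or_gt x (1 / 3) with h3 | h3
      · obtain ⟨y, hy0, hy1, rfl⟩ : ∃ y : ℝ, 0 ≤ y ∧ y ≤ 1 ∧ y / (1 + 2 * y) = x := by
          refine ⟨x / (1 - 2 * x), div_nonneg hx.1 (by linarith), ?_, ?_⟩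
          · rw [div_le_one (by linarith)]; linarith
          · have : 1 - 2 * x ≠ 0 := by linarith
            rw [show 1 + 2 * (x / (1 - 2 * x)) = 1 / (1 - 2 * x) by field_simp; ring,
              div_div_div_cancel_right₀ this, div_one]
        have e1 := count_div (m + 2) hy0 hy1
        have e2 := count_div (m + 1) hy0 hy1
        rw [show m + 3 + 1 = m + 2 + 2 by ring, show m + 3 = m + 1 + 2 by ring, e1, e2]
        have := ih (m + 1) (by omega) y ⟨hy0, hy1⟩
        push_cast at this
        nlinarith
      rcases le_or_gt (1 / 2) x with h2 | h2
      · obtain ⟨y, hy0, hy1, rfl⟩ : ∃ y : ℝ, 0 ≤ y ∧ y ≤ 1 ∧ 1 / (1 + y) = x := by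
          refine ⟨1 / x - 1, ?_, ?_, by simp⟩
          · rw [sub_nonneg, le_div_iff₀ (by linarith)]; linarith [hx.2]
          · rw [sub_le_iff_le_add, div_le_iff₀ (by linarith)]; linarith
        obtain ⟨a1, a2⟩ := count_inv_add (m + 3) hy0 hy1
        obtain ⟨a3, a4⟩ := count_inv_add (m + 2) hy0 hy1
        have := ih (m + 2) (by omega) y ⟨hy0, hy1⟩
        have h0 := hK₀ (m + 2)
        rify at a1 a2 a3 a4
        rw [abs_le] at this h0 ⊢
        push_cast at this
        simp only [show m + 2 + 1 = m + 3 by ring] at *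
        constructor <;> nlinarith
      · obtain ⟨y, hy0, hy1, rfl⟩ : ∃ y : ℝ, 0 ≤ y ∧ y < 1 ∧ 1 / (3 - y) = x := by
          refine ⟨3 - 1 / x, ?_, ?_, by simp⟩
          · rw [sub_nonneg, div_le_iff₀ (by linarith)]; linarith
          · rw [sub_lt_comm, lt_div_iff₀ (by linarith)]; linarith
        have e1 := count_inv_three_sub (m + 1) hy0 hy1
        have e2 := count_inv_three_sub m hy0 hy1
        rw [show m + 3 + 1 = m + 1 + 3 by ring, e1, e2]
        have := ih m (by omega) y ⟨hy0, hy1.le⟩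
        have h0 := hK₀ m
        rw [abs_le] at this h0 ⊢
        push_cast
        constructor <;> nlinarith

/-- Consecutive terms differ by at most K(m+1)/lam^(m+1), which is summable. -/
theorem exists_tendsto_count {lam : ℝ} (hlam : lam ^ 3 - lam ^ 2 - lam - 1 = 0) {x : ℝ}
    (hx : x ∈ Set.Icc (0 : ℝ) 1) :
    ∃ G : ℝ, Tendsto (fun m : ℕ => (count m x : ℝ) / lam ^ m) atTop (𝓝 G) := by
  obtain ⟨hl, hl'⟩ := tribonacci_root_bounds hlam
  obtain ⟨K, hK⟩ := exists_count_bound hlam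
  refine cauchySeq_tendsto_of_complete (cauchySeq_of_dist_le_of_summable
    (fun m : ℕ => K * ((m + 1 : ℕ) * (1 / lam) ^ (m + 1))) (fun m => ?_) ?_)
  · have := hK m x hx
    have hp : 0 < lam ^ (m + 1) := by positivity
    rw [dist_comm, Real.dist_eq, one_div, inv_pow, ← div_eq_mul_inv, ← mul_div_assoc,
      le_div_iff₀ hp]
    rw [← abs_of_pos hp, ← abs_mul, abs_of_pos hp]
    have e : ((count (m + 1) x : ℝ) / lam ^ (m + 1) - count m x / lam ^ m) * lam ^ (m + 1)
        = count (m + 1) x - lam * count m x := by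
      have : lam ≠ 0 := by linarith
      field_simp
      ring
    rw [e]
    exact_mod_cast this
  · have hs := summable_pow_mul_geometric_of_norm_lt_one 1 (r := 1 / lam) (by
      rw [Real.norm_eq_abs, abs_of_pos (by positivity), div_lt_one (by linarith)]
      linarith)
    simp only [pow_one] at hs
    exact ((summable_nat_add_iff 1).2 hs).mul_left K

theorem exists_tendsto_count_one {lam : ℝ} (hlam : lam ^ 3 - lam ^ 2 - lam - 1 = 0) :
    ∃ G : ℝ, 0 < G ∧ Tendsto (fun m : ℕ => (count m 1 : ℝ) / lam ^ m) atTop (𝓝 G) := by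
  obtain ⟨hl, hl'⟩ := tribonacci_root_bounds hlam
  obtain ⟨G, hG⟩ := exists_tendsto_count hlam (x := 1) (by simp)
  refine ⟨G, ?_, hG⟩
  have h1 : ∀ m, (1 : ℝ) ≤ count (m + 1) 1 := fun m => by
    exact_mod_cast one_le_count_one (by omega)
  have hb := pow_le_of_tribonacci hlam (u := fun m => (count (m + 1) 1 : ℝ))
    (fun m => by exact_mod_cast count_one_tribonacci m) (h1 0) (h1 1) (h1 2)
  have : 1 / lam ^ 3 ≤ G := by
    refine ge_of_tendsto' (hG.comp (tendsto_add_atTop_nat 1)) fun m => ?_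
    simp only [Function.comp]
    rw [div_le_div_iff₀ (by positivity) (by positivity)]
    have := mul_le_mul_of_nonneg_left (hb m) (by linarith : 0 ≤ lam)
    rw [pow_succ]
    linarith
  exact lt_of_lt_of_le (by positivity) this

theorem tendsto_Fn_of_tendsto_count {lam G H x : ℝ} (hlam : lam ^ 3 - lam ^ 2 - lam - 1 = 0)
    (h0 : 0 ≤ x) (hG : 0 < G)
    (h1 : Tendsto (fun m : ℕ => (count m 1 : ℝ) / lam ^ m) atTop (𝓝 G))
    (hx : Tendsto (fun m : ℕ => (count m x : ℝ) / lam ^ m) atTop (𝓝 H)) :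
    Tendsto (fun n => Fn n x) atTop (𝓝 (H / G)) := by
  obtain ⟨hl, hl'⟩ := tribonacci_root_bounds hlam
  have hp : Tendsto (fun m : ℕ => 1 / lam ^ m) atTop (𝓝 0) :=
    tendsto_const_nhds.div_atTop (tendsto_pow_atTop_atTop_of_one_lt (by linarith))
  have := ((hx.add hp).div (h1.add hp) (by simpa using hG.ne')).comp (tendsto_add_atTop_nat 1)
  simp only [add_zero] at this
  refine this.congr fun n => ?_
  have hl0 : lam ^ (n + 1) ≠ 0 := by positivity
  have hc : (count (n + 1) 1 : ℝ) + 1 ≠ 0 := by positivity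
  rw [Fn_eq n h0]
  simp only [Function.comp, Pi.div_apply]
  rw [← add_div, ← add_div, div_div_div_cancel_right₀ hl0]

/-- Only here does `F0`, defined by `limUnder`, become a genuine limit. -/
theorem tendsto_Fn {lam x : ℝ} (hlam : lam ^ 3 - lam ^ 2 - lam - 1 = 0)
    (hx : x ∈ Set.Icc (0 : ℝ) 1) : Tendsto (fun n => Fn n x) atTop (𝓝 (F0 x)) := by
  obtain ⟨G, hG, h1⟩ := exists_tendsto_count_one hlam
  obtain ⟨H, hH⟩ := exists_tendsto_count hlam hx
  have := tendsto_Fn_of_tendsto_count hlam hx.1 hG h1 hH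
  rwa [F0, this.limUnder_eq]

/-- The normalized counting functions converge to a fixed positive multiple of `F0`. -/
theorem exists_tendsto_count_F0 {lam : ℝ} (hlam : lam ^ 3 - lam ^ 2 - lam - 1 = 0) :
    ∃ G : ℝ, 0 < G ∧ F0 1 = 1 ∧ ∀ x ∈ Set.Icc (0 : ℝ) 1,
      Tendsto (fun m : ℕ => (count m x : ℝ) / lam ^ m) atTop (𝓝 (G * F0 x)) := by
  obtain ⟨G, hG, h1⟩ := exists_tendsto_count_one hlam
  refine ⟨G, hG, ?_, fun x hx => ?_⟩
  · rw [F0, (tendsto_Fn_of_tendsto_count hlam zero_le_one hG h1 h1).limUnder_eq, div_self hG.ne']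
  · obtain ⟨H, hH⟩ := exists_tendsto_count hlam hx
    rw [F0, (tendsto_Fn_of_tendsto_count hlam hx.1 hG h1 hH).limUnder_eq,
      mul_div_cancel₀ _ hG.ne']
    exact hH

/-! ### The functional equations -/

theorem F0_zero {lam : ℝ} (hlam : lam ^ 3 - lam ^ 2 - lam - 1 = 0) : F0 0 = 0 := by
  obtain ⟨G, hG, -, h⟩ := exists_tendsto_count_F0 hlam
  have := h 0 (by simp)
  simp only [count_zero_right, Nat.cast_zero, zero_div] at this
  have := tendsto_nhds_unique this tendsto_const_nhds
  simpa [hG.ne'] using this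

theorem F0_div {lam x : ℝ} (hlam : lam ^ 3 - lam ^ 2 - lam - 1 = 0)
    (hx : x ∈ Set.Icc (0 : ℝ) 1) : F0 (x / (1 + 2 * x)) = F0 x / lam ^ 2 := by
  obtain ⟨hl, hl'⟩ := tribonacci_root_bounds hlam
  obtain ⟨G, hG, -, h⟩ := exists_tendsto_count_F0 hlam
  have hx0 := hx.1
  have hy : x / (1 + 2 * x) ∈ Set.Icc (0 : ℝ) 1 :=
    ⟨by positivity, by rw [div_le_one (by linarith)]; linarith⟩
  have t1 := (h _ hy).comp (tendsto_add_atTop_nat 2)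
  have t2 := (h x hx).div_const (lam ^ 2)
  have := tendsto_nhds_unique t1 (t2.congr fun m => by
    simp only [Function.comp]
    rw [count_div m hx.1 hx.2, pow_add, div_div])
  rw [mul_div_assoc] at this
  exact mul_left_cancel₀ hG.ne' this

/-- The counting error of at most 1 is squeezed out after division by lam^(m+1). -/
theorem F0_inv_add {lam x : ℝ} (hlam : lam ^ 3 - lam ^ 2 - lam - 1 = 0)
    (hx : x ∈ Set.Icc (0 : ℝ) 1) : F0 (1 / (1 + x)) = 1 - F0 x / lam := by
  obtain ⟨hl, hl'⟩ := tribonacci_root_bounds hlam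
  obtain ⟨G, hG, hF1, h⟩ := exists_tendsto_count_F0 hlam
  have hx0 := hx.1
  have hy : 1 / (1 + x) ∈ Set.Icc (0 : ℝ) 1 :=
    ⟨by positivity, by rw [div_le_one (by linarith)]; linarith⟩
  have t1 := (h _ hy).comp (tendsto_add_atTop_nat 1)
  have t2 := (h x hx).div_const lam
  have t3 := (h 1 (by simp)).comp (tendsto_add_atTop_nat 1)
  have hp : Tendsto (fun m : ℕ => 1 / lam ^ (m + 1)) atTop (𝓝 0) :=
    tendsto_const_nhds.div_atTop ((tendsto_pow_atTop_atTop_of_one_lt (by linarith)).comp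
      (tendsto_add_atTop_nat 1))
  have key : ∀ m : ℕ, (count m x : ℝ) / lam ^ m / lam = count m x / lam ^ (m + 1) := fun m => by
    rw [pow_succ, div_div]
  have u1 : G * F0 (1 / (1 + x)) + G * F0 x / lam ≤ G * F0 1 :=
    le_of_tendsto_of_tendsto' (t1.add t2) t3 fun m => by
      simp only [Function.comp]
      rw [key, ← add_div]
      gcongr
      exact_mod_cast (count_inv_add m hx.1 hx.2).1
  have u2 : G * F0 1 ≤ G * F0 (1 / (1 + x)) + G * F0 x / lam + 0 :=
    le_of_tendsto_of_tendsto' t3 ((t1.add t2).add hp) fun m => by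
      simp only [Function.comp]
      rw [key, ← add_div, ← add_div]
      gcongr
      exact_mod_cast (count_inv_add m hx.1 hx.2).2
  rw [hF1] at u1 u2
  have : G * F0 (1 / (1 + x)) = G * (1 - F0 x / lam) := by
    rw [mul_sub, ← mul_div_assoc]
    linarith
  exact mul_left_cancel₀ hG.ne' this

theorem F0_div_iterate {lam : ℝ} (hlam : lam ^ 3 - lam ^ 2 - lam - 1 = 0) (n : ℕ) {x : ℝ}
    (hx : x ∈ Set.Icc (0 : ℝ) 1) : F0 (x / (1 + 2 * n * x)) = F0 x / lam ^ (2 * n) := by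
  have hx0 := hx.1
  induction n with
  | zero => simp
  | succ n ih =>
    have hy : x / (1 + 2 * n * x) ∈ Set.Icc (0 : ℝ) 1 := by
      have : 0 ≤ 2 * (n : ℝ) * x := by positivity
      exact ⟨by positivity, by rw [div_le_one (by linarith)]; linarith [hx.2]⟩
    have := F0_div hlam hy
    rw [ih, div_div, div_div (F0 x), ← pow_add] at this
    rw [mul_add, mul_one, ← this]
    congr 1
    have : 1 + 2 * (n : ℝ) * x ≠ 0 := by positivity
    have : 1 + 2 * ((n : ℝ) + 1) * x ≠ 0 := by positivity
    have : 1 + 2 * (n : ℝ) * x + 2 * x ≠ 0 := by positivity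
    push_cast
    field_simp
    ring

end OddCF

/-- The first conjunct says that the limit defining `F⁰` exists on `[0, 1]`. The last equation is
the second functional equation at `x = 0`, where `1 / (2n + 1/x)` is read as `0`. -/
theorem proposition2 (lam : ℝ) (hlam : lam ^ 3 - lam ^ 2 - lam - 1 = 0) :
    (∀ x ∈ Set.Icc (0 : ℝ) 1,
      Tendsto (fun n : ℕ => OddCF.Fn n x) atTop (𝓝 (OddCF.F0 x))) ∧
    ∀ n : ℕ, 1 ≤ n →
      (∀ x ∈ Set.Icc (0 : ℝ) 1,
        OddCF.F0 x / lam ^ (2 * n - 1) =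
          1 / lam ^ (2 * n - 2) - OddCF.F0 (1 / (2 * (n : ℝ) - 1 + x))) ∧
      (∀ x ∈ Set.Ioc (0 : ℝ) 1,
        OddCF.F0 x / lam ^ (2 * n) = OddCF.F0 (1 / (2 * (n : ℝ) + 1 / x))) ∧
      OddCF.F0 0 / lam ^ (2 * n) = OddCF.F0 0 := by
  obtain ⟨hl, hl'⟩ := tribonacci_root_bounds hlam
  refine ⟨fun x hx => OddCF.tendsto_Fn hlam hx, fun n hn => ⟨fun x hx => ?_, fun x hx => ?_, ?_⟩⟩
  · obtain ⟨k, rfl⟩ : ∃ k, n = k + 1 := ⟨n - 1, by omega⟩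
    have hx0 := hx.1
    have hy : 1 / (1 + x) ∈ Set.Icc (0 : ℝ) 1 :=
      ⟨by positivity, by rw [div_le_one (by linarith)]; linarith⟩
    -- Adding 2k = 2n - 2 to the reciprocal of 1/(1+x) gives 2n - 1 + x.
    have := OddCF.F0_div_iterate hlam k hy
    rw [OddCF.F0_inv_add hlam hx] at this
    have e : 1 / (2 * ((k + 1 : ℕ) : ℝ) - 1 + x)
        = 1 / (1 + x) / (1 + 2 * k * (1 / (1 + x))) := by
      have : 2 * ((k : ℝ) + 1) - 1 + x ≠ 0 := by
        have : (0 : ℝ) ≤ k := k.cast_nonneg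
        linarith
      push_cast
      field_simp
      ring
    rw [e, this, show 2 * (k + 1) - 1 = 2 * k + 1 by omega,
      show 2 * (k + 1) - 2 = 2 * k by omega, pow_succ]
    field_simp
    ring
  · have hx0 := hx.1
    rw [← OddCF.F0_div_iterate hlam n ⟨hx.1.le, hx.2⟩]
    congr 1
    field_simp
    ring
  · rw [OddCF.F0_zero hlam, zero_div]
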